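/- Let $\mathbb{F}_q$ be a finite field with $q \equiv 1 \pmod 4$ elements, written $q = 2^A m + 1$ with $A \ge 2$ and $m$ odd. Let $r \ge 3$ be odd with $\gcd(q,r)=1$, let $d_r = \operatorname{ord}_r(q)$ be the multiplicative order of $q$ modulo $r$, and let $K = v_2(q^{d_r}-1)$ be the exponent of $2$ in $q^{d_r}-1$. In an algebraic closure of $\mathbb{F}_q$ let $U_n$ be the set of primitive $2^n$-th roots of unity and $\Omega(r)$ the set of primitive $r$-th roots of unity. For $w \in \Omega(r)$ let $S_{i,w} = S_i(w, w^q, \dots, w^{q^{d_r-1}})$, where $S_i$ is the $i$-th elementary symmetric polynomial and $S_0=1$. Every product below is taken over the \emph{distinct} polynomials of the indicated form, and ``complete factorization over $\mathbb{F}_q$'' means that these polynomials have coefficients in $\mathbb{F}_q$ and are monic and irreducible over $\mathbb{F}_q$. Write $\Phi_N$ for the $N$-th cyclotomic polynomial over $\mathbb{F}_q$. 1. If $2 \le n \le A$, then $$\Phi_{2^n r}(x) = \prod_{u\in U_n}\prod_{w\in\Omega(r)}\left(\sum_{i=0}^{d_r} u^i S_{i,w}\, x^{d_r-i}\right)$$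 is the complete factorization of $\Phi_{2^n r}$ over $\mathbb{F}_q$. For $n=1$ the complete factorization is the same expression with $u=1$: $$\Phi_{2r}(x) = \prod_{w\in\Omega(r)}\left(\sum_{i=0}^{d_r} S_{i,w}\, x^{d_r-i}\right).$$ 2. Let $n > A$. (a) If $d_r$ is odd, then $$\Phi_{2^n r}(x) = \prod_{u\in U_A}\prod_{w\in\Omega(r)}\left(\sum_{i=0}^{d_r} u^i S_{i,w}\, x^{2^{n-A}(d_r-i)}\right)$$ is the complete factorization of $\Phi_{2^n r}$ over $\mathbb{F}_q$. (b) Let $d_r$ be even. (i) If $A < n \le K$, the complete factorization of $\Phi_{2^n r}$ over $\mathbb{F}_q$ is $$\Phi_{2^n r}(x) = \prod_{u\in U_A}\prod_{w\in\Omega(r)}\left(x^{d_r} + \sum_{i=1}^{d_r} a_{n,i}\, x^{d_r-i}\right),$$ where, for each $u \in U_A$ and $w \in \Omega(r)$, $(a_{n,1},\dots,a_{n,d_r})$ runs over all vectors in $\mathbb{F}_q^{d_r}$ obtained from the initial values $a_{A,k} = u^k S_{k,w} \in \mathbb{F}_q$, $1\le k\le d_r$, by solving successively for $\nu = A+1,\dots,n$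 the system of non-linear recurrence relations $$\sum_{\substack{i+j=2k\\ 0\le i,j\le d_r}} (-1)^j a_{\nu,i}\, a_{\nu,j} = a_{\nu-1,k}, \qquad 1\le k\le d_r,\qquad a_{\nu,0}=1,$$ in $\mathbb{F}_q$; at each of these steps the system has a solution in $\mathbb{F}_q$. (ii) If $n > K$, the complete factorization of $\Phi_{2^n r}$ over $\mathbb{F}_q$ is $$\Phi_{2^n r}(x) = \prod_{u\in U_A}\prod_{w\in\Omega(r)}\left(x^{2^{n-K}d_r} + \sum_{i=1}^{d_r} a_{K,i}\, x^{2^{n-K}(d_r-i)}\right),$$ where the vectors $(a_{K,1},\dots,a_{K,d_r})$ are those obtained in (i) for $n = K$. -/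

import Mathlib

open Polynomial

noncomputable section

namespace CyclotomicFactorization

/-- The set of primitive `k`-th roots of unity in the algebraic closure of `F`.
`U_n` is `primRoots F (2 ^ n)` and `Ω(r)` is `primRoots F r`. -/
def primRoots (F : Type*) [Field F] (k : ℕ) : Set (AlgebraicClosure F) :=
  {z | IsPrimitiveRoot z k}

/-- `S_{i,w} = S_i(w, w^q, …, w^{q^{d-1}})`, the `i`-th elementary symmetric polynomial evaluated
at the `d` conjugates of an element `w` of degree `d` over the field with `q` elements. -/
def conjSymm {L : Type*} [Field L] (q d i : ℕ) (w : L) : L :=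
  ((Multiset.range d).map fun j => w ^ q ^ j).esymm i

/-- The polynomial `∑_{i=0}^{d} u^i S_{i,w} x^{e (d - i)}`. -/
def twistedFactor {L : Type*} [Field L] (q d e : ℕ) (u w : L) : L[X] :=
  ∑ i ∈ Finset.range (d + 1), C (u ^ i * conjSymm q d i w) * X ^ (e * (d - i))

/-- The polynomial `x^{e d} + ∑_{i=1}^{d} a_i x^{e (d - i)}`. -/
def coeffPoly {F : Type*} [Field F] (d e : ℕ) (a : ℕ → F) : F[X] :=
  X ^ (e * d) + ∑ i ∈ Finset.Icc 1 d, C (a i) * X ^ (e * (d - i))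

/-- The system `∑_{i+j=2k} (-1)^j b_i b_j = a_k`, `1 ≤ k ≤ d`, where `0 ≤ i, j ≤ d` and `b_0 = 1`
(the leading coefficient): `b` is obtained from `a` by one step of the recurrence. -/
def RecurrenceStep {F : Type*} [Field F] (d : ℕ) (a b : ℕ → F) : Prop :=
  b 0 = 1 ∧ ∀ k ∈ Finset.Icc 1 d,
    ∑ p ∈ (Finset.range (d + 1) ×ˢ Finset.range (d + 1)).filter (fun p => p.1 + p.2 = 2 * k),
      (-1) ^ p.2 * b p.1 * b p.2 = a k

/-- `IsCoeffs q A d u w n a`: the coefficients `a = (a_{n,0} = 1, a_{n,1}, …, a_{n,d})` in `F` are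
obtained from the initial values `a_{A,k} = u^k S_{k,w}` by `n - A` steps of the recurrence.
Values `a i` with `i > d` are irrelevant. -/
inductive IsCoeffs {F : Type*} [Field F] (q A d : ℕ) (u w : AlgebraicClosure F) :
    ℕ → (ℕ → F) → Prop
  | init (a : ℕ → F) (h0 : a 0 = 1)
      (h : ∀ k ∈ Finset.Icc 1 d,
        algebraMap F (AlgebraicClosure F) (a k) = u ^ k * conjSymm q d k w) :
      IsCoeffs q A d u w A a
  | step (n : ℕ) (a b : ℕ → F) (ha : IsCoeffs q A d u w n a) (hb : RecurrenceStep d a b) :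
      IsCoeffs q A d u w (n + 1) b

/-- The polynomials in `S`, given with coefficients in the algebraic closure of `F`, all have
coefficients in `F`, are monic and irreducible over `F`, are finite in number, and the product of
these distinct polynomials is `P`. -/
def IsCompleteFactorization {F : Type*} [Field F] (P : F[X])
    (S : Set (AlgebraicClosure F)[X]) : Prop :=
  ∃ T : Finset F[X],
    (fun f : F[X] => f.map (algebraMap F (AlgebraicClosure F))) '' (T : Set F[X]) = S ∧
    (∀ f ∈ T, f.Monic ∧ Irreducible f) ∧
    P = ∏ f ∈ T, f

end CyclotomicFactorization

end

namespace CyclotomicFactorization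

/-! When `N` is prime to `q`, the irreducible factors of `Φ_N` over `F` are the minimal polynomials
of the primitive `N`-th roots of unity, each occurring once because `Φ_N` is squarefree. Every case
therefore amounts to identifying a set of minimal polynomials, and degrees decide: such a root has
degree equal to the order of `q` modulo `N`, which for `N = 2^n r` is `2^(n-K) d` with truncated
subtraction (lifting the exponent, `orderOf_natCast_two_pow_mul`).

For `2 ≤ n ≤ A` the roots are the `-(u w)` with `u` fixed by Frobenius, so the conjugates are `-u
w^(q^j)` and Vieta gives the twisted factor. Above level `K` each step doubles the degree, so the
minimal polynomial of `z` is that of a power `z^(2^j)` with `x` replaced by `x^(2^j)`. If `d` is odd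
then `A = K` and these two regimes cover everything.

If `d` is even, the degree stays `d` from level `A` to level `K`. There the minimal polynomials `g`
of `y` and `f` of `y^2` satisfy `g(x) g(-x) = f(x^2)`, whose coefficients are the recurrence.
Conversely, for any solution over `F`, each root of `g` squares to a root of `f`, hence is a
primitive root of the next level; it has degree `d`, so `g` is its minimal polynomial. -/

open UniqueFactorizationMonoid in
/-- The irreducible factors of a cyclotomic polynomial over a finite field are the minimal
polynomials of the primitive roots of unity. -/
theorem isCompleteFactorization_cyclotomic {F : Type*} [Field F] {N : ℕ} [NeZero (N : F)]
    {S : Set (AlgebraicClosure F)[X]}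
    (hS : ∀ f, f ∈ S ↔ ∃ z : AlgebraicClosure F, IsPrimitiveRoot z N ∧
      f = (minpoly F z).map (algebraMap F (AlgebraicClosure F))) :
    IsCompleteFactorization (cyclotomic N F) S := by
  classical
  have hN : NeZero (N : AlgebraicClosure F) := by
    refine ⟨fun h => NeZero.ne (N : F) ((algebraMap F (AlgebraicClosure F)).injective ?_)⟩
    rw [map_natCast, h, map_zero]
  have h0 : cyclotomic N F ≠ 0 := cyclotomic_ne_zero N F
  have hroot (z : AlgebraicClosure F) :
      IsPrimitiveRoot z N ↔ aeval z (cyclotomic N F) = 0 := by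
    rw [← isRoot_cyclotomic_iff, ← map_cyclotomic N (algebraMap F (AlgebraicClosure F)),
      IsRoot, eval_map_algebraMap]
  have hmonic : ∀ f ∈ normalizedFactors (cyclotomic N F), f.Monic ∧ Irreducible f := by
    intro f hf
    have hirr := irreducible_of_normalized_factor f hf
    refine ⟨?_, hirr⟩
    rw [← normalize_normalized_factor f hf]
    exact monic_normalize hirr.ne_zero
  refine ⟨(normalizedFactors (cyclotomic N F)).toFinset, ?_, ?_, ?_⟩
  · ext f
    rw [hS]
    constructor
    · rintro ⟨g, hg, rfl⟩
      have hg' : g ∈ normalizedFactors (cyclotomic N F) := Multiset.mem_toFinset.1 hg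
      obtain ⟨hm, hirr⟩ := hmonic g hg'
      obtain ⟨z, hz⟩ := IsAlgClosed.exists_aeval_eq_zero (AlgebraicClosure F) g
        (degree_pos_of_irreducible hirr).ne'
      refine ⟨z, (hroot z).2 ?_, ?_⟩
      · obtain ⟨c, hc⟩ := dvd_of_mem_normalizedFactors hg'
        rw [hc, map_mul, hz, zero_mul]
      · rw [← minpoly.eq_of_irreducible_of_monic hirr hz hm]
    · rintro ⟨z, hz, rfl⟩
      refine ⟨minpoly F z, ?_, rfl⟩
      have hint : IsIntegral F z := Algebra.IsIntegral.isIntegral z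
      have hd : minpoly F z ∣ cyclotomic N F := minpoly.dvd F z ((hroot z).1 hz)
      obtain ⟨g, hg, hag⟩ := exists_mem_normalizedFactors_of_dvd h0 (minpoly.irreducible hint) hd
      rw [eq_of_monic_of_associated (minpoly.monic hint) (hmonic g hg).1 hag]
      exact Multiset.mem_toFinset.2 hg
  · intro f hf
    exact hmonic f (Multiset.mem_toFinset.1 hf)
  · have hnd : (normalizedFactors (cyclotomic N F)).Nodup :=
      (squarefree_iff_nodup_normalizedFactors h0).1 (squarefree_cyclotomic N F)
    have hprod := leadingCoeff_mul_prod_normalizedFactors (cyclotomic N F)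
    rw [(cyclotomic.monic N F).leadingCoeff, C_1, one_mul] at hprod
    rw [Finset.prod_multiset_count_of_subset _ _ subset_rfl] at hprod
    refine hprod.symm.trans (Finset.prod_congr rfl fun f hf => by
      rw [Multiset.count_eq_one_of_mem hnd (Multiset.mem_toFinset.1 hf), pow_one])

/-- If `q ≡ 1 (mod 4)`, `q` has order `d` modulo an odd number `r`, and `2 ^ K` exactly divides
`q ^ d - 1`, then `q` has order `2 ^ (n - K) * d` modulo `2 ^ n * r`. -/
theorem orderOf_natCast_two_pow_mul {q r d K : ℕ} (hq : 4 ∣ q - 1) (hq1 : 1 < q) (hr : Odd r)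
    (hd0 : 0 < d) (hd : d = orderOf (q : ZMod r)) (hK : K = padicValNat 2 (q ^ d - 1)) (n : ℕ) :
    orderOf (q : ZMod (2 ^ n * r)) = 2 ^ (n - K) * d := by
  have hone (e : ℕ) : 1 ≤ q ^ e := Nat.one_le_pow _ _ (by omega)
  have key (N e : ℕ) : orderOf (q : ZMod N) ∣ e ↔ N ∣ q ^ e - 1 := by
    rw [orderOf_dvd_iff_pow_eq_one, ← Nat.cast_pow, ← Nat.cast_one,
      ZMod.natCast_eq_natCast_iff, Nat.ModEq.comm, Nat.modEq_iff_dvd' (hone e)]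
  have hcop : Nat.Coprime (2 ^ n) r := (Nat.coprime_two_left.2 hr).pow_left n
  -- Two natural numbers with the same multiples are equal.
  refine Nat.dvd_right_iff_eq.1 fun e => ?_
  have hsplit : 2 ^ n * r ∣ q ^ e - 1 ↔ 2 ^ n ∣ q ^ e - 1 ∧ d ∣ e := by
    rw [hd, key r]
    exact ⟨fun h => ⟨dvd_of_mul_right_dvd h, dvd_of_mul_left_dvd h⟩,
      fun h => hcop.mul_dvd_of_dvd_of_dvd h.1 h.2⟩
  rw [key, hsplit]
  have hlift (f : ℕ) : 2 ^ n ∣ q ^ (d * f) - 1 ↔ 2 ^ (n - K) ∣ f := by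
    -- Lifting the exponent at 2 with base `q^d`: divisibility by 4, not just 2, gives `v_2(q^(df) -
    -- 1) = K + v_2(f)`.
    have h4 : (4 : ℤ) ∣ (q : ℤ) ^ d - 1 := by
      have h : (4 : ℤ) ∣ (q : ℤ) - 1 := by
        rw [← Nat.cast_one, ← Nat.cast_sub hq1.le]
        exact_mod_cast hq
      exact h.trans (by simpa using sub_dvd_pow_sub_pow (q : ℤ) 1 d)
    have hodd : ¬ (2 : ℤ) ∣ (q : ℤ) ^ d := by omega
    have hlte := Int.two_pow_sub_pow' f h4 hodd
    have hKm : emultiplicity (2 : ℤ) ((q : ℤ) ^ d - 1) = K := by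
      have hne : q ^ d - 1 ≠ 0 := by
        have := Nat.one_lt_pow hd0.ne' hq1
        omega
      rw [hK, padicValNat_eq_emultiplicity hne, ← Int.natCast_emultiplicity,
        Nat.cast_sub (hone d)]
      simp
    rw [one_pow, ← pow_mul, hKm] at hlte
    have hcast : 2 ^ n ∣ q ^ (d * f) - 1 ↔ (2 : ℤ) ^ n ∣ (q : ℤ) ^ (d * f) - 1 := by
      rw [← Int.natCast_dvd_natCast, Nat.cast_sub (hone _)]
      simp
    have hcast' : 2 ^ (n - K) ∣ f ↔ (2 : ℤ) ^ (n - K) ∣ (f : ℤ) := by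
      rw [← Int.natCast_dvd_natCast]
      simp
    rw [hcast, hcast', pow_dvd_iff_le_emultiplicity, pow_dvd_iff_le_emultiplicity, hlte,
      ENat.natCast_sub, tsub_le_iff_left]
  constructor
  · rintro ⟨h, f, rfl⟩
    rw [mul_comm]
    exact Nat.mul_dvd_mul_left d ((hlift f).1 h)
  · rintro ⟨f, rfl⟩
    refine ⟨?_, ⟨2 ^ (n - K) * f, by ring⟩⟩
    rw [mul_right_comm, mul_comm _ d, hlift]
    exact dvd_mul_right _ _

/-! ### Minimal polynomials of roots of unity and Frobenius orbits -/

section FiniteField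

variable {F : Type*} [Field F] [Fintype F]

theorem ne_zero_of_coprime_card {N : ℕ} (hN : (Fintype.card F).Coprime N) : N ≠ 0 := by
  rintro rfl
  exact Fintype.one_lt_card.ne' ((Nat.coprime_zero_right _).1 hN)

theorem neZero_natCast_of_coprime_card {N : ℕ} (hN : (Fintype.card F).Coprime N) :
    NeZero (N : F) := by
  refine ⟨fun h => ?_⟩
  obtain ⟨p, hp⟩ := CharP.exists F
  have hpp : p.Prime :=
    (CharP.char_is_prime_or_zero F p).resolve_right (CharP.char_ne_zero_of_finite F p)
  have h1 : p ∣ N := (CharP.cast_eq_zero_iff F p N).1 h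
  have h2 : p ∣ Fintype.card F := (CharP.cast_eq_zero_iff F p _).1 (Nat.cast_card_eq_zero F)
  exact hpp.one_lt.ne' (Nat.dvd_one.1 (hN ▸ Nat.dvd_gcd h2 h1))

/-- The degree over a finite field of a primitive `N`-th root of unity. -/
theorem natDegree_minpoly_of_isPrimitiveRoot {L : Type*} [Field L] [Algebra F L] {N : ℕ}
    (hN : (Fintype.card F).Coprime N) {z : L} (hz : IsPrimitiveRoot z N) :
    (minpoly F z).natDegree = orderOf ((Fintype.card F : ℕ) : ZMod N) := by
  obtain ⟨p, -, f, hp, hcard⟩ := FiniteField.card' F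
  have : Fact p.Prime := ⟨hp⟩
  have hN0 := ne_zero_of_coprime_card hN
  have hpN : p.Coprime N := by
    rw [hcard] at hN
    exact (Nat.coprime_pow_left_iff f.pos _ _).1 hN
  have hint : IsIntegral F z := (hz.isIntegral (Nat.pos_of_ne_zero hN0)).tower_top
  have hdvd : minpoly F z ∣ cyclotomic N F := by
    refine minpoly.dvd F z ?_
    have := hz.isRoot_cyclotomic (Nat.pos_of_ne_zero hN0)
    rwa [← map_cyclotomic N (algebraMap F L), IsRoot, eval_map_algebraMap] at this
  rw [natDegree_of_dvd_cyclotomic_of_irreducible hcard hpN hdvd (minpoly.irreducible hint),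
    ← orderOf_units, ZMod.coe_unitOfCoprime, hcard]

theorem aeval_pow_card_pow {L : Type*} [Field L] [Algebra F L] {z : L} {f : F[X]}
    (hz : aeval z f = 0) (j : ℕ) : aeval (z ^ Fintype.card F ^ j) f = 0 := by
  induction j with
  | zero => simpa using hz
  | succ j ih =>
    have := aeval_algHom_apply (FiniteField.frobeniusAlgHom F L) (z ^ Fintype.card F ^ j) f
    rw [ih, map_zero, FiniteField.coe_frobeniusAlgHom] at this
    rwa [pow_succ, pow_mul]

/-- The minimal polynomial of a primitive root of unity as a product over its Frobenius orbit. -/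
theorem minpoly_map_eq_prod {L : Type*} [Field L] [Algebra F L] {N : ℕ}
    (hN : (Fintype.card F).Coprime N) {z : L} (hz : IsPrimitiveRoot z N) :
    (minpoly F z).map (algebraMap F L) =
      ((Multiset.range (orderOf ((Fintype.card F : ℕ) : ZMod N))).map
        fun j => X - C (z ^ Fintype.card F ^ j)).prod := by
  have hdeg := natDegree_minpoly_of_isPrimitiveRoot hN hz
  have hN0 := ne_zero_of_coprime_card hN
  have hint : IsIntegral F z := (hz.isIntegral (Nat.pos_of_ne_zero hN0)).tower_top
  have hmon := (minpoly.monic hint).map (algebraMap F L)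
  set D := orderOf ((Fintype.card F : ℕ) : ZMod N)
  -- Equality of two conjugates means that powers of `q` agree modulo `N`, and `D` is the order of
  -- `q` there.
  have hinj : Set.InjOn (fun j => z ^ Fintype.card F ^ j) (Set.Iio D) := by
    intro i hi j hj hij
    refine pow_injOn_Iio_orderOf hi hj ?_
    have hfin : IsOfFinOrder z :=
      isOfFinOrder_iff_pow_eq_one.2 ⟨N, Nat.pos_of_ne_zero hN0, hz.pow_eq_one⟩
    have := (hfin.pow_eq_pow_iff_modEq).1 hij
    rw [← hz.eq_orderOf, ← ZMod.natCast_eq_natCast_iff] at this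
    simpa using this
  have hnodup : ((Multiset.range D).map fun j => z ^ Fintype.card F ^ j).Nodup := by
    refine Multiset.Nodup.map_on (fun i hi j hj hij => hinj ?_ ?_ hij) (Multiset.nodup_range D)
    · simpa using hi
    · simpa using hj
  have hdvd : (((Multiset.range D).map fun j => z ^ Fintype.card F ^ j).map
      fun a => X - C a).prod ∣ (minpoly F z).map (algebraMap F L) := by
    rw [Multiset.prod_X_sub_C_dvd_iff_le_roots hmon.ne_zero, Multiset.le_iff_subset hnodup]
    intro y hy
    obtain ⟨j, -, rfl⟩ := Multiset.mem_map.1 hy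
    rw [mem_roots hmon.ne_zero, IsRoot, eval_map_algebraMap]
    exact aeval_pow_card_pow (minpoly.aeval F z) j
  have hm2 := monic_multiset_prod_of_monic
    ((Multiset.range D).map fun j => z ^ Fintype.card F ^ j) (fun a : L => X - C a)
    fun a _ => monic_X_sub_C a
  have := eq_of_monic_of_dvd_of_natDegree_le hm2 hmon hdvd (by
    rw [natDegree_map, hdeg, natDegree_multiset_prod_X_sub_C_eq_card]
    simp)
  rw [this, Multiset.map_map]
  rfl

end FiniteField

/-! ### Twisted factors as products over conjugates -/

section TwistedFactor

variable {L : Type*} [Field L]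

theorem twistedFactor_eq_prod (q d : ℕ) (u w : L) :
    twistedFactor q d 1 u w =
      ((Multiset.range d).map fun j => X + C (u * w ^ q ^ j)).prod := by
  -- Vieta; the scalar form `u •` lets homogeneity of `esymm` pull out `u ^ i`.
  have h := Multiset.prod_X_add_C_eq_sum_esymm ((Multiset.range d).map fun j => u • w ^ q ^ j)
  rw [Multiset.map_map, Multiset.card_map, Multiset.card_range] at h
  simp only [Function.comp_def, smul_eq_mul] at h
  rw [h, twistedFactor]
  refine Finset.sum_congr rfl fun i _ => ?_
  rw [one_mul, conjSymm, ← smul_eq_mul (u ^ i), Multiset.pow_smul_esymm, Multiset.map_map]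
  rfl

theorem twistedFactor_eq_expand (q d e : ℕ) (u w : L) :
    twistedFactor q d e u w = expand L e (twistedFactor q d 1 u w) := by
  simp [twistedFactor, map_sum, pow_mul]

theorem coeffPoly_eq_expand (d e : ℕ) (a : ℕ → L) :
    coeffPoly d e a = expand L e (coeffPoly d 1 a) := by
  simp [coeffPoly, map_sum, pow_mul]

end TwistedFactor

/-- For `u` in the base field, the twisted factor attached to `u` and `w` is the minimal polynomial
of `-(u * w)`. -/
theorem twistedFactor_eq_map_minpoly {F : Type*} [Field F] [Fintype F] {L : Type*} [Field L]
    [Algebra F L] {N : ℕ} (hodd : Odd (Fintype.card F)) (hN : (Fintype.card F).Coprime N)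
    {u w : L} (hu : u ^ Fintype.card F = u) (hz : IsPrimitiveRoot (-(u * w)) N) :
    twistedFactor (Fintype.card F) (orderOf ((Fintype.card F : ℕ) : ZMod N)) 1 u w =
      (minpoly F (-(u * w))).map (algebraMap F L) := by
  rw [twistedFactor_eq_prod, minpoly_map_eq_prod hN hz]
  congr 1
  have hu' (j : ℕ) : u ^ Fintype.card F ^ j = u := by
    induction j with
    | zero => simp
    | succ j ih => rw [pow_succ, pow_mul, ih, hu]
  refine Multiset.map_congr rfl fun j _ => ?_
  -- As `q` is odd, Frobenius keeps the sign, and `X - C (-(u w^(q^j)))` becomes `X + C (u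
  -- w^(q^j))`.
  rw [(hodd.pow).neg_pow, mul_pow, hu', C_neg, sub_neg_eq_add]

/-! ### Splitting roots of unity and extracting square roots -/

section RootsOfUnity

variable {L : Type*} [Field L]

theorem isPrimitiveRoot_mul_of_coprime {a b : ℕ} (hab : a.Coprime b) {u w : L}
    (hu : IsPrimitiveRoot u a) (hw : IsPrimitiveRoot w b) : IsPrimitiveRoot (u * w) (a * b) := by
  have h := (Commute.all u w).orderOf_mul_eq_mul_orderOf_of_coprime
    (by rwa [← hu.eq_orderOf, ← hw.eq_orderOf])
  rw [← hu.eq_orderOf, ← hw.eq_orderOf] at h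
  exact h ▸ IsPrimitiveRoot.orderOf (u * w)

theorem exists_mul_of_isPrimitiveRoot {a b : ℕ} (ha : a ≠ 0) (hb : b ≠ 0) (hab : a.Coprime b)
    {z : L} (hz : IsPrimitiveRoot z (a * b)) :
    ∃ u w : L, IsPrimitiveRoot u a ∧ IsPrimitiveRoot w b ∧ z = u * w := by
  have hpos : 0 < a * b := by positivity
  have hu : IsPrimitiveRoot (z ^ b) a := hz.pow hpos (mul_comm a b)
  have hw : IsPrimitiveRoot (z ^ a) b := hz.pow hpos rfl
  have : NeZero (a * b) := ⟨hpos.ne'⟩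
  -- The product `z^b * z^a` is itself a primitive `ab`-th root, so `z` is a power of it; this
  -- replaces Bézout coefficients.
  obtain ⟨i, -, hi⟩ := (isPrimitiveRoot_mul_of_coprime hab hu hw).eq_pow_of_pow_eq_one hz.pow_eq_one
  have hcop : i.Coprime (a * b) :=
    ((isPrimitiveRoot_mul_of_coprime hab hu hw).pow_iff_coprime hpos i).1 (by rwa [hi])
  refine ⟨(z ^ b) ^ i, (z ^ a) ^ i, hu.pow_of_coprime i hcop.coprime_mul_right_right,
    hw.pow_of_coprime i hcop.coprime_mul_left_right, ?_⟩
  rw [← mul_pow, hi]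

/-- If `(-u)^l = 1` then `u^(2l) = 1`, so `4 ∣ 2l`, `l` is even, and the sign disappears. -/
theorem isPrimitiveRoot_neg_of_four_dvd {N : ℕ} (hN : 4 ∣ N) {u : L} (hu : IsPrimitiveRoot u N) :
    IsPrimitiveRoot (-u) N := by
  refine ⟨?_, fun l hl => ?_⟩
  · rw [(even_iff_two_dvd.2 (dvd_trans (by norm_num) hN)).neg_pow, hu.pow_eq_one]
  · have h2 : N ∣ 2 * l := by
      refine hu.dvd_of_pow_eq_one _ ?_
      rw [← (even_two_mul l).neg_pow, mul_comm, pow_mul, hl, one_pow]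
    have hev : Even l := even_iff_two_dvd.2 (by have := hN.trans h2; omega)
    exact hu.dvd_of_pow_eq_one _ (by rwa [hev.neg_pow] at hl)

/-- The order of `y^2` is that of `y` divided by its gcd with 2. A gcd of 1 would make the order of
`y` equal to the even number `N`, a contradiction. -/
theorem isPrimitiveRoot_of_sq {N : ℕ} (hN : 2 ∣ N) {y : L}
    (hy : IsPrimitiveRoot (y ^ 2) N) : IsPrimitiveRoot y (2 * N) := by
  have h := orderOf_pow' y two_ne_zero
  rw [← hy.eq_orderOf] at h
  have ho : orderOf y = 2 * N := by
    rcases (Nat.dvd_prime Nat.prime_two).1 (Nat.gcd_dvd_right (orderOf y) 2) with h1 | h1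
    · rw [h1, Nat.div_one] at h
      rw [← h, Nat.gcd_eq_right hN] at h1
      omega
    · have h2 := Nat.gcd_dvd_left (orderOf y) 2
      rw [h1] at h h2
      omega
  exact ho ▸ IsPrimitiveRoot.orderOf y

theorem isPrimitiveRoot_of_pow_two_pow {n r : ℕ} (hn : n ≠ 0) (k : ℕ) {y : L}
    (hy : IsPrimitiveRoot (y ^ 2 ^ k) (2 ^ n * r)) : IsPrimitiveRoot y (2 ^ (n + k) * r) := by
  induction k generalizing y with
  | zero => simpa using hy
  | succ k ih =>
    rw [pow_succ', pow_mul] at hy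
    have h := isPrimitiveRoot_of_sq ((dvd_pow_self 2 (by omega)).mul_right r) (ih hy)
    rwa [← mul_assoc, ← pow_succ'] at h

theorem isPrimitiveRoot_pow_two_pow {n r : ℕ} (hr : r ≠ 0) (k : ℕ) {y : L}
    (hy : IsPrimitiveRoot y (2 ^ (n + k) * r)) : IsPrimitiveRoot (y ^ 2 ^ k) (2 ^ n * r) :=
  hy.pow (by positivity) (by ring)

/-- The minus sign matches the positive signs in the twisted factor; it is absorbed into `u` because
`4 ∣ 2^n`. -/
theorem isPrimitiveRoot_two_pow_mul_iff {n r : ℕ} (hn : 2 ≤ n) (hr : Odd r) {z : L} :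
    IsPrimitiveRoot z (2 ^ n * r) ↔
      ∃ u w : L, IsPrimitiveRoot u (2 ^ n) ∧ IsPrimitiveRoot w r ∧ z = -(u * w) := by
  have h4 : 4 ∣ 2 ^ n := pow_dvd_pow 2 hn
  have hcop : (2 ^ n).Coprime r := (Nat.coprime_two_left.2 hr).pow_left n
  constructor
  · intro hz
    obtain ⟨u, w, hu, hw, rfl⟩ := exists_mul_of_isPrimitiveRoot (by positivity) hr.pos.ne' hcop hz
    exact ⟨-u, w, isPrimitiveRoot_neg_of_four_dvd h4 hu, hw, by ring⟩
  · rintro ⟨u, w, hu, hw, rfl⟩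
    rw [← neg_mul]
    exact isPrimitiveRoot_mul_of_coprime hcop (isPrimitiveRoot_neg_of_four_dvd h4 hu) hw

theorem isPrimitiveRoot_two_mul_iff {r : ℕ} (hr : Odd r) (h2 : (2 : L) ≠ 0) {z : L} :
    IsPrimitiveRoot z (2 * r) ↔ ∃ w : L, IsPrimitiveRoot w r ∧ z = -(1 * w) := by
  have hcop : Nat.Coprime 2 r := Nat.coprime_two_left.2 hr
  constructor
  · intro hz
    obtain ⟨u, w, hu, hw, rfl⟩ := exists_mul_of_isPrimitiveRoot two_ne_zero hr.pos.ne' hcop hz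
    exact ⟨w, hw, by rw [hu.eq_neg_one_of_two_right]; ring⟩
  · rintro ⟨w, hw, rfl⟩
    have h1 : IsPrimitiveRoot (-1 : L) 2 := by
      refine IsPrimitiveRoot.neg_one (ringChar L) fun h => h2 ?_
      have := ringChar.Nat.cast_ringChar (R := L)
      rw [h] at this
      exact_mod_cast this
    rw [← neg_mul]
    exact isPrimitiveRoot_mul_of_coprime hcop h1 hw

end RootsOfUnity

/-! ### The recurrence as the identity `g(x) g(-x) = f(x²)` -/

section Recurrence

variable {F : Type*} [Field F]

theorem coeff_sum_C_mul_X_pow_sub (d k : ℕ) (c : ℕ → F) :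
    (∑ i ∈ Finset.range (d + 1), C (c i) * X ^ (d - i)).coeff k =
      if k ≤ d then c (d - k) else 0 := by
  simp_rw [finsetSum_coeff, coeff_C_mul_X_pow]
  split_ifs with h
  · rw [Finset.sum_eq_single_of_mem (d - k)] <;> grind
  · exact Finset.sum_eq_zero fun i _ => if_neg (by omega)

theorem coeffPoly_eq_sum (d : ℕ) {a : ℕ → F} (ha : a 0 = 1) :
    coeffPoly d 1 a = ∑ i ∈ Finset.range (d + 1), C (a i) * X ^ (d - i) := by
  rw [Finset.range_eq_Ico, Finset.sum_eq_sum_Ico_succ_bot (Nat.succ_pos d), ha, coeffPoly]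
  simp only [one_mul, C_1, Nat.sub_zero]
  rfl

theorem coeff_coeffPoly (d k : ℕ) {a : ℕ → F} (ha : a 0 = 1) :
    (coeffPoly d 1 a).coeff k = if k ≤ d then a (d - k) else 0 := by
  rw [coeffPoly_eq_sum d ha, coeff_sum_C_mul_X_pow_sub]

theorem natDegree_coeffPoly_le (d : ℕ) {a : ℕ → F} (ha : a 0 = 1) :
    (coeffPoly d 1 a).natDegree ≤ d :=
  natDegree_le_iff_coeff_eq_zero.2 fun k hk => by
    rw [coeff_coeffPoly d k ha, if_neg (by omega)]

theorem monic_coeffPoly (d : ℕ) {a : ℕ → F} (ha : a 0 = 1) : (coeffPoly d 1 a).Monic :=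
  monic_of_natDegree_le_of_coeff_eq_one d (natDegree_coeffPoly_le d ha)
    (by rw [coeff_coeffPoly d d ha]; simpa)

theorem natDegree_coeffPoly (d : ℕ) {a : ℕ → F} (ha : a 0 = 1) :
    (coeffPoly d 1 a).natDegree = d :=
  natDegree_eq_of_le_of_coeff_ne_zero (natDegree_coeffPoly_le d ha)
    (by rw [coeff_coeffPoly d d ha]; simp [ha])

theorem coeffPoly_coeff {d : ℕ} {g : F[X]} (hg : g.Monic) (hd : g.natDegree = d) :
    coeffPoly d 1 (fun i => g.coeff (d - i)) = g := by
  have h0 : (fun i => g.coeff (d - i)) 0 = 1 := by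
    simpa [← hd] using hg.coeff_natDegree
  ext k
  rw [coeff_coeffPoly d k h0]
  split_ifs with h
  · rw [Nat.sub_sub_self h]
  · rw [coeff_eq_zero_of_natDegree_lt (by omega)]

/-- The recurrence says that `g(x) g(-x) = f(x²)` for the polynomials with coefficients `b`
and `a`. -/
theorem RecurrenceStep.mul_comp_neg_X {d : ℕ} (hd : Even d) {a b : ℕ → F} (ha : a 0 = 1)
    (h : RecurrenceStep d a b) :
    coeffPoly d 1 b * (coeffPoly d 1 b).comp (-X) = expand F 2 (coeffPoly d 1 a) := by
  obtain ⟨hb, h⟩ := h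
  have hX : (-X : F[X]) = C (-1) * X := by simp
  ext s
  rw [coeff_mul, coeff_expand two_pos, hX]
  simp only [comp_C_mul_X_coeff]
  split_ifs with hs
  · obtain ⟨t, rfl⟩ := hs
    rw [Nat.mul_div_cancel_left t two_pos, coeff_coeffPoly d t ha]
    split_ifs with ht
    · have hk : ∑ p ∈ (Finset.range (d + 1) ×ˢ Finset.range (d + 1)).filter
          (fun p => p.1 + p.2 = 2 * (d - t)), (-1) ^ p.2 * b p.1 * b p.2 = a (d - t) := by
        -- The system starts at `k = 1`; the equation for `k = 0` holds because both leading
        -- coefficients are 1.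
        rcases Nat.eq_zero_or_pos (d - t) with h0 | h0
        · rw [h0, ha, Finset.sum_eq_single_of_mem (0, 0)]
          · simp [hb]
          · simp
          · rintro ⟨i, j⟩ hp hne
            simp at hp hne
            omega
        · exact h (d - t) (Finset.mem_Icc.2 ⟨h0, by omega⟩)
      rw [← hk]
      symm
      -- Recurrence indices count down from the leading term, hence the reversal `i ↦ d - i`;
      -- antidiagonal pairs with an entry above `d` contribute zero.
      refine Finset.sum_of_injOn (fun p => (d - p.1, d - p.2)) ?_ ?_ ?_ ?_
      · rintro ⟨i, j⟩ hp ⟨i', j'⟩ hp' heq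
        simp at hp hp' heq
        ext <;> simp <;> omega
      · rintro ⟨i, j⟩ hp
        simp at hp ⊢
        omega
      · rintro ⟨i, j⟩ hp hn
        by_contra hne
        have hi : i ≤ d := by
          by_contra hi
          simp [coeff_coeffPoly d _ hb, hi] at hne
        have hj : j ≤ d := by
          by_contra hj
          simp [coeff_coeffPoly d _ hb, hj] at hne
        refine hn ⟨(d - i, d - j), ?_, ?_⟩
        · simp at hp ⊢
          omega
        · simp
          omega
      · rintro ⟨i, j⟩ hp
        simp at hp
        have hi : i ≤ d := by omega
        have hj : j ≤ d := by omega
        -- This is where evenness of `d` enters.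
        have hpar : (-1 : F) ^ (d - j) = (-1) ^ j := by
          rcases Nat.even_or_odd j with hj' | hj'
          · rw [hj'.neg_one_pow, (hd.tsub hj').neg_one_pow]
          · rw [hj'.neg_one_pow, (Nat.Even.sub_odd hj hd hj').neg_one_pow]
        simp only [coeff_coeffPoly d _ hb]
        simp [hpar, Nat.sub_sub_self hi, Nat.sub_sub_self hj]
        ring
    · refine Finset.sum_eq_zero fun p hp => ?_
      rw [Finset.HasAntidiagonal.mem_antidiagonal] at hp
      rw [coeff_coeffPoly d _ hb, coeff_coeffPoly d _ hb]
      by_cases h1 : p.1 ≤ d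
      · rw [if_neg (show ¬ p.2 ≤ d by omega)]
        simp
      · rw [if_neg h1]
        simp
  -- In odd degree the two indices have opposite parity, so swapping them pairs terms of opposite
  -- sign.
  · refine Finset.sum_involution (fun p _ => p.swap) ?_ ?_ ?_ ?_
    · rintro ⟨i, j⟩ hp
      simp only [Finset.HasAntidiagonal.mem_antidiagonal] at hp
      rcases Nat.even_or_odd i with hi | hi
      · have hj : Odd j := by grind
        simp [hi.neg_one_pow, hj.neg_one_pow]
        ring
      · have hj : Even j := by grind
        simp [hi.neg_one_pow, hj.neg_one_pow]
        ring
    · rintro ⟨i, j⟩ hp - heq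
      simp at hp heq
      omega
    · rintro ⟨i, j⟩ hp
      simp at hp ⊢
      omega
    · rintro ⟨i, j⟩ hp
      simp

end Recurrence

/-! ### Minimal polynomials under taking powers -/

section Minpoly

variable {F : Type*} [Field F] {L : Type*} [Field L] [Algebra F L]

theorem eq_minpoly_of_natDegree_le {z : L} {f : F[X]} (hf : f.Monic) (hz : aeval z f = 0)
    (hdeg : f.natDegree ≤ (minpoly F z).natDegree) : f = minpoly F z :=
  eq_of_monic_of_dvd_of_natDegree_le (minpoly.monic ⟨f, hf, hz⟩) hf (minpoly.dvd F z hz) hdeg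

/-- The expanded polynomial is monic and vanishes at `z`, and its degree is already that of the
minimal polynomial. -/
theorem minpoly_eq_expand {z : L} {p : ℕ} (hp : 0 < p) (hz : IsIntegral F z)
    (hdeg : (minpoly F z).natDegree = p * (minpoly F (z ^ p)).natDegree) :
    minpoly F z = expand F p (minpoly F (z ^ p)) := by
  refine (eq_minpoly_of_natDegree_le ((minpoly.monic (hz.pow p)).expand hp) ?_ ?_).symm
  · rw [expand_aeval, minpoly.aeval]
  · rw [natDegree_expand, hdeg, mul_comm]

/-- The coefficients of the minimal polynomial of `y` solve the recurrence whose right-hand side is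
given by the minimal polynomial of `y ^ 2`. -/
theorem exists_recurrenceStep {d : ℕ} (hd : Even d) {y : L} (hy : IsIntegral F y)
    (hy1 : (minpoly F y).natDegree = d) (hy2 : (minpoly F (y ^ 2)).natDegree = d) {a : ℕ → F}
    (ha0 : a 0 = 1) (ha : coeffPoly d 1 a = minpoly F (y ^ 2)) :
    ∃ b, RecurrenceStep d a b ∧ coeffPoly d 1 b = minpoly F y := by
  set b : ℕ → F := fun i => (minpoly F y).coeff (d - i) with hb
  have hbp : coeffPoly d 1 b = minpoly F y := coeffPoly_coeff (minpoly.monic hy) hy1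
  have hb0 : b 0 = 1 := by
    simpa [hb, ← hy1] using (minpoly.monic hy).coeff_natDegree
  -- Define the right-hand side by the system itself, so that `b` solves it trivially. The resulting
  -- polynomial is monic of degree `d` and vanishes at `y^2`, so it is the minimal polynomial and
  -- `a'` agrees with `a` up to `d`.
  let a' : ℕ → F := fun k => if k = 0 then 1 else
    ∑ p ∈ (Finset.range (d + 1) ×ˢ Finset.range (d + 1)).filter (fun p => p.1 + p.2 = 2 * k),
      (-1) ^ p.2 * b p.1 * b p.2
  have ha'0 : a' 0 = 1 := if_pos rfl
  have hstep : RecurrenceStep d a' b := by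
    refine ⟨hb0, fun k hk => ?_⟩
    have : k ≠ 0 := by
      have := (Finset.mem_Icc.1 hk).1
      omega
    simp [a', this]
  have heq : coeffPoly d 1 a' = coeffPoly d 1 a := by
    rw [ha]
    refine eq_minpoly_of_natDegree_le (monic_coeffPoly d ha'0) ?_ ?_
    · rw [← expand_aeval, ← hstep.mul_comp_neg_X hd ha'0, hbp, map_mul, minpoly.aeval, zero_mul]
    · rw [hy2, natDegree_coeffPoly d ha'0]
  refine ⟨b, ⟨hb0, fun k hk => ?_⟩, hbp⟩
  rw [hstep.2 k hk]
  have h := congrArg (fun f => f.coeff (d - k)) heq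
  have hk' := (Finset.mem_Icc.1 hk).2
  simpa only [coeff_coeffPoly d _ ha0, coeff_coeffPoly d _ ha'0, Nat.sub_le, if_true,
    Nat.sub_sub_self hk'] using h

end Minpoly

/-- The arithmetic data of the factorization of `Φ_{2^n r}` over a finite field with `q` elements:
`2 ^ A` divides `q - 1`, and the order of `q` modulo `2 ^ n * r` is `2 ^ (n - K) * d`. -/
structure OrderData (F : Type*) [Field F] [Fintype F] (A r d K : ℕ) : Prop where
  two_le : 2 ≤ A
  le : A ≤ K
  odd : Odd r
  pos : 0 < d
  two_pow_dvd : 2 ^ A ∣ Fintype.card F - 1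
  coprime : (Fintype.card F).Coprime r
  orderOf_eq : ∀ n, orderOf ((Fintype.card F : ℕ) : ZMod (2 ^ n * r)) = 2 ^ (n - K) * d

/-! ### Degrees, and factorizations by twisted factors -/

namespace OrderData

variable {F : Type*} [Field F] [Fintype F] {A r d K : ℕ}

theorem odd_card (h : OrderData F A r d K) : Odd (Fintype.card F) := by
  have h1 : 2 ∣ Fintype.card F - 1 :=
    (dvd_pow_self 2 (by have := h.two_le; omega)).trans h.two_pow_dvd
  have := Fintype.one_lt_card (α := F)
  exact Nat.odd_iff.2 (by omega)

theorem coprime_two_pow_mul (h : OrderData F A r d K) (n : ℕ) :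
    (Fintype.card F).Coprime (2 ^ n * r) :=
  ((Nat.coprime_two_right.2 h.odd_card).pow_right n).mul_right h.coprime

theorem natDegree_minpoly (h : OrderData F A r d K) {n : ℕ} {z : AlgebraicClosure F}
    (hz : IsPrimitiveRoot z (2 ^ n * r)) : (minpoly F z).natDegree = 2 ^ (n - K) * d := by
  rw [natDegree_minpoly_of_isPrimitiveRoot (h.coprime_two_pow_mul n) hz, h.orderOf_eq]

theorem pow_card_eq (h : OrderData F A r d K) {k : ℕ} (hk : k ≤ A) {u : AlgebraicClosure F}
    (hu : IsPrimitiveRoot u (2 ^ k)) : u ^ Fintype.card F = u := by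
  obtain ⟨c, hc⟩ := (pow_dvd_pow 2 hk).trans h.two_pow_dvd
  have h1 : Fintype.card F = 2 ^ k * c + 1 := by
    have := Fintype.one_lt_card (α := F)
    omega
  rw [h1, pow_succ, pow_mul, hu.pow_eq_one, one_pow, one_mul]

theorem twistedFactor_eq (h : OrderData F A r d K) {n : ℕ} (hn : n ≤ K) {u w : AlgebraicClosure F}
    (hu : u ^ Fintype.card F = u) (hz : IsPrimitiveRoot (-(u * w)) (2 ^ n * r)) :
    twistedFactor (Fintype.card F) d 1 u w =
      (minpoly F (-(u * w))).map (algebraMap F (AlgebraicClosure F)) := by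
  have := twistedFactor_eq_map_minpoly h.odd_card (h.coprime_two_pow_mul n) hu hz
  rwa [h.orderOf_eq, Nat.sub_eq_zero_of_le hn, pow_zero, one_mul] at this

/-- The minimal polynomial of a primitive `2 ^ n * r`-th root of unity in terms of that of a power
of order `2 ^ k * r`. -/
theorem minpoly_eq_expand (h : OrderData F A r d K) {n k : ℕ} (hkn : k ≤ n) (hk : k ≤ K)
    (hsub : n - K = n - k) {z : AlgebraicClosure F} (hz : IsPrimitiveRoot z (2 ^ n * r)) :
    minpoly F z = expand F (2 ^ (n - k)) (minpoly F (z ^ 2 ^ (n - k))) := by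
  refine CyclotomicFactorization.minpoly_eq_expand (by positivity)
    (Algebra.IsIntegral.isIntegral z) ?_
  have hz' : IsPrimitiveRoot (z ^ 2 ^ (n - k)) (2 ^ k * r) :=
    isPrimitiveRoot_pow_two_pow h.odd.pos.ne' (n - k) (by rwa [Nat.add_sub_cancel' hkn])
  rw [h.natDegree_minpoly hz, h.natDegree_minpoly hz', hsub, Nat.sub_eq_zero_of_le hk, pow_zero,
    one_mul]

theorem isCompleteFactorization_two_mul (h : OrderData F A r d K) :
    IsCompleteFactorization (cyclotomic (2 * r) F)
      {f | ∃ w ∈ primRoots F r, f = twistedFactor (Fintype.card F) d 1 1 w} := by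
  have hcop := h.coprime_two_pow_mul 1
  rw [pow_one] at hcop
  have := neZero_natCast_of_coprime_card hcop
  have h2 : (2 : AlgebraicClosure F) ≠ 0 := by
    have := (neZero_natCast_of_coprime_card (F := F) (Nat.coprime_two_right.2 h.odd_card)).ne
    rw [← map_ofNat (algebraMap F (AlgebraicClosure F)) 2, _root_.map_ne_zero]
    exact_mod_cast this
  refine isCompleteFactorization_cyclotomic fun f => ?_
  have key {w : AlgebraicClosure F} (hz : IsPrimitiveRoot (-(1 * w)) (2 * r)) :
      twistedFactor (Fintype.card F) d 1 1 w =
        (minpoly F (-(1 * w))).map (algebraMap F (AlgebraicClosure F)) :=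
    h.twistedFactor_eq (n := 1) (by have := h.two_le; have := h.le; omega) (one_pow _)
      (by rwa [pow_one])
  constructor
  · rintro ⟨w, hw, rfl⟩
    have hz := (isPrimitiveRoot_two_mul_iff h.odd h2).2 ⟨w, hw, rfl⟩
    exact ⟨_, hz, key hz⟩
  · rintro ⟨z, hz, rfl⟩
    obtain ⟨w, hw, rfl⟩ := (isPrimitiveRoot_two_mul_iff h.odd h2).1 hz
    exact ⟨w, hw, (key hz).symm⟩

/-- Here `k` is the level from which one expands: `k = n` for `n ≤ A`, and `k = A = K` when `d` is
odd and `n > A`. The truncated equation `hsub` covers both. -/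
theorem isCompleteFactorization_twistedFactor (h : OrderData F A r d K) {n k : ℕ} (hk2 : 2 ≤ k)
    (hkA : k ≤ A) (hkn : k ≤ n) (hsub : n - K = n - k) :
    IsCompleteFactorization (cyclotomic (2 ^ n * r) F)
      {f | ∃ u ∈ primRoots F (2 ^ k), ∃ w ∈ primRoots F r,
        f = twistedFactor (Fintype.card F) d (2 ^ (n - k)) u w} := by
  have := neZero_natCast_of_coprime_card (h.coprime_two_pow_mul n)
  have hkK := hkA.trans h.le
  refine isCompleteFactorization_cyclotomic fun f => ?_
  have key {u w z : AlgebraicClosure F} (hu : IsPrimitiveRoot u (2 ^ k))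
      (hz : IsPrimitiveRoot z (2 ^ n * r)) (hzu : z ^ 2 ^ (n - k) = -(u * w)) :
      twistedFactor (Fintype.card F) d (2 ^ (n - k)) u w =
        (minpoly F z).map (algebraMap F (AlgebraicClosure F)) := by
    have hz' : IsPrimitiveRoot (-(u * w)) (2 ^ k * r) :=
      hzu ▸ isPrimitiveRoot_pow_two_pow h.odd.pos.ne' (n - k) (by rwa [Nat.add_sub_cancel' hkn])
    rw [twistedFactor_eq_expand, h.twistedFactor_eq hkK (h.pow_card_eq hkA hu) hz',
      h.minpoly_eq_expand hkn hkK hsub hz, map_expand, hzu]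
  constructor
  · rintro ⟨u, hu, w, hw, rfl⟩
    have hz' := (isPrimitiveRoot_two_pow_mul_iff hk2 h.odd).2 ⟨u, w, hu, hw, rfl⟩
    obtain ⟨z, hzu⟩ := IsAlgClosed.exists_pow_nat_eq (-(u * w))
      (show 0 < 2 ^ (n - k) by positivity)
    rw [← hzu] at hz'
    have hz := isPrimitiveRoot_of_pow_two_pow (by omega) _ hz'
    rw [Nat.add_sub_cancel' hkn] at hz
    exact ⟨z, hz, key hu hz hzu⟩
  · rintro ⟨z, hz, rfl⟩
    have hz' : IsPrimitiveRoot (z ^ 2 ^ (n - k)) (2 ^ k * r) :=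
      isPrimitiveRoot_pow_two_pow h.odd.pos.ne' (n - k) (by rwa [Nat.add_sub_cancel' hkn])
    obtain ⟨u, w, hu, hw, hzu⟩ := (isPrimitiveRoot_two_pow_mul_iff hk2 h.odd).1 hz'
    exact ⟨u, hu, w, hw, (key hu hz hzu).symm⟩

end OrderData

/-! ### Factorizations by the recurrence -/

theorem IsCoeffs.le {F : Type*} [Field F] {q A d n : ℕ} {u w : AlgebraicClosure F} {a : ℕ → F}
    (h : IsCoeffs q A d u w n a) : A ≤ n := by
  induction h with
  | init => exact le_rfl
  | step n a b _ _ ih => omega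

theorem IsCoeffs.zero_eq_one {F : Type*} [Field F] {q A d n : ℕ} {u w : AlgebraicClosure F}
    {a : ℕ → F} (h : IsCoeffs q A d u w n a) : a 0 = 1 := by
  cases h with
  | init _ h0 _ => exact h0
  | step _ _ _ _ hb => exact hb.1

theorem map_coeffPoly_eq_twistedFactor_iff {F : Type*} [Field F] {q d : ℕ}
    {u w : AlgebraicClosure F} {a : ℕ → F} (ha : a 0 = 1) :
    (coeffPoly d 1 a).map (algebraMap F (AlgebraicClosure F)) = twistedFactor q d 1 u w ↔
      ∀ k ∈ Finset.Icc 1 d,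
        algebraMap F (AlgebraicClosure F) (a k) = u ^ k * conjSymm q d k w := by
  have h1 (k : ℕ) : ((coeffPoly d 1 a).map (algebraMap F (AlgebraicClosure F))).coeff k =
      if k ≤ d then algebraMap F (AlgebraicClosure F) (a (d - k)) else 0 := by
    rw [coeff_map, coeff_coeffPoly d k ha]
    split_ifs <;> simp
  have h2 (k : ℕ) : (twistedFactor q d 1 u w).coeff k =
      if k ≤ d then u ^ (d - k) * conjSymm q d (d - k) w else 0 := by
    simp_rw [twistedFactor, one_mul]
    exact coeff_sum_C_mul_X_pow_sub d k fun i => u ^ i * conjSymm q d i w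
  constructor
  · intro h k hk
    have hk' := (Finset.mem_Icc.1 hk).2
    have h3 := congrArg (fun f => f.coeff (d - k)) h
    simpa only [h1, h2, Nat.sub_le, if_true, Nat.sub_sub_self hk'] using h3
  · intro h
    ext k
    rw [h1, h2]
    split_ifs with hk
    · rcases Nat.eq_zero_or_pos (d - k) with h0 | h0
      · rw [h0, ha]
        simp [conjSymm, Multiset.esymm]
      · exact h _ (Finset.mem_Icc.2 ⟨h0, Nat.sub_le _ _⟩)
    · rfl

namespace OrderData

variable {F : Type*} [Field F] [Fintype F] {A r d K : ℕ}

/-- All roots of the polynomials produced by the recurrence are primitive roots of unity. -/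
theorem isPrimitiveRoot_of_isCoeffs (h : OrderData F A r d K) (hd : Even d) {n : ℕ}
    {u w : AlgebraicClosure F} (hu : IsPrimitiveRoot u (2 ^ A)) (hw : IsPrimitiveRoot w r)
    {a : ℕ → F} (ha : IsCoeffs (Fintype.card F) A d u w n a) {z : AlgebraicClosure F}
    (hz : aeval z (coeffPoly d 1 a) = 0) : IsPrimitiveRoot z (2 ^ n * r) := by
  induction ha generalizing z with
  | init a h0 ha =>
    have hz' := (isPrimitiveRoot_two_pow_mul_iff h.two_le h.odd).2 ⟨u, w, hu, hw, rfl⟩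
    rw [← eval_map_algebraMap, (map_coeffPoly_eq_twistedFactor_iff h0).2 ha,
      h.twistedFactor_eq h.le (h.pow_card_eq le_rfl hu) hz',
      minpoly_map_eq_prod (h.coprime_two_pow_mul A) hz', eval_multiset_prod,
      Multiset.prod_eq_zero_iff, Multiset.map_map] at hz
    obtain ⟨j, -, hj⟩ := Multiset.mem_map.1 hz
    have hj' : z = (-(u * w)) ^ Fintype.card F ^ j := by
      simpa [sub_eq_zero] using hj
    rw [hj']
    -- At level `A` the roots are the Frobenius conjugates of `-(u w)`, and `q^j` is prime to the
    -- order.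
    exact hz'.pow_of_coprime _ ((h.coprime_two_pow_mul A).pow_left j)
  | step n a b ha hb ih =>
    -- Evaluate `g(x) g(-x) = f(x²)` at a root of `g`.
    have hz2 : aeval (z ^ 2) (coeffPoly d 1 a) = 0 := by
      rw [← expand_aeval, ← hb.mul_comp_neg_X hd ha.zero_eq_one, map_mul, hz, zero_mul]
    have hn := ha.le.trans' h.two_le
    exact isPrimitiveRoot_of_pow_two_pow (by omega) 1 (by simpa using ih hz2)

/-- For `n ≤ K` every root is a primitive root of unity of degree exactly `d`. Hence every solution
of the recurrence gives an irreducible polynomial, whichever choices were made on the way. -/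
theorem coeffPoly_eq_minpoly (h : OrderData F A r d K) (hd : Even d) {n : ℕ} (hn : n ≤ K)
    {u w : AlgebraicClosure F} (hu : IsPrimitiveRoot u (2 ^ A)) (hw : IsPrimitiveRoot w r)
    {a : ℕ → F} (ha : IsCoeffs (Fintype.card F) A d u w n a) {z : AlgebraicClosure F}
    (hz : aeval z (coeffPoly d 1 a) = 0) : coeffPoly d 1 a = minpoly F z := by
  have hz' := h.isPrimitiveRoot_of_isCoeffs hd hu hw ha hz
  refine eq_minpoly_of_natDegree_le (monic_coeffPoly d ha.zero_eq_one) hz ?_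
  rw [natDegree_coeffPoly d ha.zero_eq_one, h.natDegree_minpoly hz', Nat.sub_eq_zero_of_le hn,
    pow_zero, one_mul]

theorem exists_aeval_coeffPoly (h : OrderData F A r d K) {a : ℕ → F} (ha : a 0 = 1) :
    ∃ z : AlgebraicClosure F, aeval z (coeffPoly d 1 a) = 0 := by
  refine IsAlgClosed.exists_aeval_eq_zero _ _ ?_
  rw [degree_eq_natDegree (monic_coeffPoly d ha).ne_zero, natDegree_coeffPoly d ha]
  exact_mod_cast h.pos.ne'

theorem exists_isCoeffs_init (h : OrderData F A r d K) {u w : AlgebraicClosure F}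
    (hu : IsPrimitiveRoot u (2 ^ A)) (hw : IsPrimitiveRoot w r) :
    ∃ a : ℕ → F, IsCoeffs (Fintype.card F) A d u w A a ∧
      coeffPoly d 1 a = minpoly F (-(u * w)) := by
  have hz := (isPrimitiveRoot_two_pow_mul_iff h.two_le h.odd).2 ⟨u, w, hu, hw, rfl⟩
  have hmon : (minpoly F (-(u * w))).Monic := minpoly.monic (Algebra.IsIntegral.isIntegral _)
  have hdeg : (minpoly F (-(u * w))).natDegree = d := by
    rw [h.natDegree_minpoly hz, Nat.sub_eq_zero_of_le h.le, pow_zero, one_mul]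
  have hcoeff := coeffPoly_coeff hmon hdeg
  have h0 : (fun i => (minpoly F (-(u * w))).coeff (d - i)) 0 = 1 := by
    simpa [← hdeg] using hmon.coeff_natDegree
  refine ⟨_, IsCoeffs.init _ h0 ((map_coeffPoly_eq_twistedFactor_iff h0).1 ?_), hcoeff⟩
  rw [hcoeff, h.twistedFactor_eq h.le (h.pow_card_eq le_rfl hu) hz]

theorem exists_recurrenceStep (h : OrderData F A r d K) (hd : Even d) {n : ℕ} (hn0 : n ≠ 0)
    (hn : n + 1 ≤ K) {a : ℕ → F} (ha0 : a 0 = 1) {y : AlgebraicClosure F}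
    (hy : IsPrimitiveRoot (y ^ 2) (2 ^ n * r)) (ha : coeffPoly d 1 a = minpoly F (y ^ 2)) :
    ∃ b, RecurrenceStep d a b ∧ coeffPoly d 1 b = minpoly F y := by
  have hy' := isPrimitiveRoot_of_pow_two_pow hn0 1 (by simpa using hy)
  refine CyclotomicFactorization.exists_recurrenceStep hd (Algebra.IsIntegral.isIntegral y)
    ?_ ?_ ha0 ha
  · rw [h.natDegree_minpoly hy', Nat.sub_eq_zero_of_le hn, pow_zero, one_mul]
  · rw [h.natDegree_minpoly hy, Nat.sub_eq_zero_of_le (by omega), pow_zero, one_mul]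

/-- Completeness: squaring descends from `z` to level `A`, and the minimal polynomials met on the
way are successive solutions. -/
theorem exists_isCoeffs (h : OrderData F A r d K) (hd : Even d) {n : ℕ} (hAn : A ≤ n)
    (hn : n ≤ K) {z : AlgebraicClosure F} (hz : IsPrimitiveRoot z (2 ^ n * r)) :
    ∃ u ∈ primRoots F (2 ^ A), ∃ w ∈ primRoots F r, ∃ a : ℕ → F,
      IsCoeffs (Fintype.card F) A d u w n a ∧ coeffPoly d 1 a = minpoly F z := by
  induction n, hAn using Nat.le_induction generalizing z with
  | base =>
    obtain ⟨u, w, hu, hw, rfl⟩ := (isPrimitiveRoot_two_pow_mul_iff h.two_le h.odd).1 hz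
    exact ⟨u, hu, w, hw, h.exists_isCoeffs_init hu hw⟩
  | succ n hAn ih =>
    have hz2 : IsPrimitiveRoot (z ^ 2) (2 ^ n * r) := by
      simpa using isPrimitiveRoot_pow_two_pow h.odd.pos.ne' 1 hz
    obtain ⟨u, hu, w, hw, a, ha, hap⟩ := ih (by omega) hz2
    obtain ⟨b, hb, hbp⟩ := h.exists_recurrenceStep hd (by have := h.two_le; omega) hn
      ha.zero_eq_one hz2 hap
    exact ⟨u, hu, w, hw, b, ha.step n a b hb, hbp⟩

/-- Used with `k = n` for `A < n ≤ K` and with `k = K` for `n > K`. -/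
theorem isCompleteFactorization_coeffPoly (h : OrderData F A r d K) (hd : Even d) {n k : ℕ}
    (hAk : A ≤ k) (hk : k ≤ K) (hkn : k ≤ n) (hsub : n - K = n - k) :
    IsCompleteFactorization (cyclotomic (2 ^ n * r) F)
      {f | ∃ u ∈ primRoots F (2 ^ A), ∃ w ∈ primRoots F r, ∃ a : ℕ → F,
        IsCoeffs (Fintype.card F) A d u w k a ∧
        f = (coeffPoly d (2 ^ (n - k)) a).map (algebraMap F (AlgebraicClosure F))} := by
  have := neZero_natCast_of_coprime_card (h.coprime_two_pow_mul n)
  have h2 := h.two_le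
  refine isCompleteFactorization_cyclotomic fun f => ?_
  constructor
  · rintro ⟨u, hu, w, hw, a, ha, rfl⟩
    obtain ⟨y, hy⟩ := h.exists_aeval_coeffPoly ha.zero_eq_one
    obtain ⟨z, rfl⟩ := IsAlgClosed.exists_pow_nat_eq y (show 0 < 2 ^ (n - k) by positivity)
    have hz := isPrimitiveRoot_of_pow_two_pow (by omega) _
      (h.isPrimitiveRoot_of_isCoeffs hd hu hw ha hy)
    rw [Nat.add_sub_cancel' hkn] at hz
    refine ⟨z, hz, ?_⟩
    rw [coeffPoly_eq_expand, h.coeffPoly_eq_minpoly hd hk hu hw ha hy,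
      h.minpoly_eq_expand hkn hk hsub hz]
  · rintro ⟨z, hz, rfl⟩
    have hz' : IsPrimitiveRoot (z ^ 2 ^ (n - k)) (2 ^ k * r) :=
      isPrimitiveRoot_pow_two_pow h.odd.pos.ne' (n - k) (by rwa [Nat.add_sub_cancel' hkn])
    obtain ⟨u, hu, w, hw, a, ha, hap⟩ := h.exists_isCoeffs hd hAk hk hz'
    refine ⟨u, hu, w, hw, a, ha, ?_⟩
    rw [coeffPoly_eq_expand, hap, h.minpoly_eq_expand hkn hk hsub hz]

end OrderData

/-- For `q ≡ 1 (mod 4)` the exponent of `2` in `q ^ d - 1` is at least that in `q - 1`, with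
equality if `d` is odd. -/
theorem le_padicValNat_pow_sub_one {q A m d : ℕ} (hqA : q = 2 ^ A * m + 1) (hA : 2 ≤ A)
    (hm : Odd m) (hd : 0 < d) :
    A ≤ padicValNat 2 (q ^ d - 1) ∧ (Odd d → A = padicValNat 2 (q ^ d - 1)) := by
  have hpos : 0 < 2 ^ A * m := Nat.mul_pos (by positivity) hm.pos
  have h4 : (4 : ℤ) ∣ (q : ℤ) - 1 := by
    rw [hqA]
    push_cast
    rw [add_sub_cancel_right]
    exact Dvd.dvd.mul_right (pow_dvd_pow (2 : ℤ) hA) _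
  have hlte := Int.two_pow_sub_pow' d h4 (by omega)
  have hq1 : 1 < q ^ d := Nat.one_lt_pow hd.ne' (by omega)
  have hbase : emultiplicity (2 : ℤ) ((q : ℤ) - 1) = A := by
    rw [hqA]
    push_cast
    rw [add_sub_cancel_right, emultiplicity_mul Int.prime_two,
      emultiplicity_pow_self_of_prime Int.prime_two, emultiplicity_eq_zero.2, add_zero]
    have := Nat.odd_iff.1 hm
    omega
  have hval : emultiplicity (2 : ℤ) ((q : ℤ) ^ d - 1) = padicValNat 2 (q ^ d - 1) := by
    rw [padicValNat_eq_emultiplicity (by omega), ← Int.natCast_emultiplicity,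
      Nat.cast_sub hq1.le]
    simp
  rw [one_pow, hval, hbase] at hlte
  constructor
  · have : (A : ℕ∞) ≤ padicValNat 2 (q ^ d - 1) := hlte ▸ le_self_add
    exact_mod_cast this
  · intro hodd
    rw [emultiplicity_eq_zero.2, add_zero] at hlte
    · exact_mod_cast hlte.symm
    · have := Nat.odd_iff.1 hodd
      omega

end CyclotomicFactorization

/-! ### Assembly of the cases -/

open CyclotomicFactorization in
theorem mainTheorem1 {F : Type*} [Field F] [Fintype F] (q A m r d K : ℕ)
    (hq : Fintype.card F = q) (hqA : q = 2 ^ A * m + 1) (hA : 2 ≤ A) (hm : Odd m)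
    (hr3 : 3 ≤ r) (hr : Odd r) (hqr : Nat.Coprime q r)
    (hd : d = orderOf (q : ZMod r)) (hK : K = padicValNat 2 (q ^ d - 1)) :
    -- 1. `n = 1` (the only factor `x + 1` of `Φ_2` has `u = 1`)
    IsCompleteFactorization (Polynomial.cyclotomic (2 * r) F)
      {f | ∃ w ∈ primRoots F r, f = twistedFactor q d 1 1 w} ∧
    -- 1. `2 ≤ n ≤ A`
    (∀ n, 2 ≤ n → n ≤ A →
      IsCompleteFactorization (Polynomial.cyclotomic (2 ^ n * r) F)
        {f | ∃ u ∈ primRoots F (2 ^ n), ∃ w ∈ primRoots F r, f = twistedFactor q d 1 u w}) ∧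
    -- 2 (a)
    (Odd d → ∀ n, A < n →
      IsCompleteFactorization (Polynomial.cyclotomic (2 ^ n * r) F)
        {f | ∃ u ∈ primRoots F (2 ^ A), ∃ w ∈ primRoots F r,
          f = twistedFactor q d (2 ^ (n - A)) u w}) ∧
    -- 2 (b)
    (Even d →
      -- the initial values lie in `F`, and the system is solvable in `F` at each step up to `K`
      (∀ u ∈ primRoots F (2 ^ A), ∀ w ∈ primRoots F r,
        (∃ a : ℕ → F, IsCoeffs q A d u w A a) ∧
        ∀ n, A < n → n ≤ K → ∀ a : ℕ → F, IsCoeffs q A d u w (n - 1) a →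
          ∃ b : ℕ → F, RecurrenceStep d a b) ∧
      -- (i)
      (∀ n, A < n → n ≤ K →
        IsCompleteFactorization (Polynomial.cyclotomic (2 ^ n * r) F)
          {f | ∃ u ∈ primRoots F (2 ^ A), ∃ w ∈ primRoots F r, ∃ a : ℕ → F,
            IsCoeffs q A d u w n a ∧
            f = (coeffPoly d 1 a).map (algebraMap F (AlgebraicClosure F))}) ∧
      -- (ii)
      (∀ n, K < n →
        IsCompleteFactorization (Polynomial.cyclotomic (2 ^ n * r) F)
          {f | ∃ u ∈ primRoots F (2 ^ A), ∃ w ∈ primRoots F r, ∃ a : ℕ → F,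
            IsCoeffs q A d u w K a ∧
            f = (coeffPoly d (2 ^ (n - K)) a).map (algebraMap F (AlgebraicClosure F))})) := by
  subst hq
  have hd0 : 0 < d := by
    have : NeZero r := ⟨by omega⟩
    rw [hd, ← ZMod.coe_unitOfCoprime _ hqr, orderOf_units]
    exact orderOf_pos _
  obtain ⟨hAK, hodd⟩ := le_padicValNat_pow_sub_one hqA hA hm hd0
  rw [← hK] at hAK hodd
  have hsub : Fintype.card F - 1 = 2 ^ A * m := by omega
  have hdvd : 2 ^ A ∣ Fintype.card F - 1 := hsub ▸ dvd_mul_right _ _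
  have h : OrderData F A r d K :=
    { two_le := hA
      le := hAK
      odd := hr
      pos := hd0
      two_pow_dvd := hdvd
      coprime := hqr
      orderOf_eq := orderOf_natCast_two_pow_mul ((pow_dvd_pow 2 hA).trans hdvd)
        Fintype.one_lt_card hr hd0 hd hK }
  refine ⟨h.isCompleteFactorization_two_mul, fun n hn2 hnA => ?_, fun hdo n hn => ?_,
    fun hde => ⟨fun u hu w hw => ⟨?_, fun n hAn hnK a ha => ?_⟩, fun n hAn hnK => ?_,
      fun n hKn => ?_⟩⟩
  · simpa using h.isCompleteFactorization_twistedFactor (n := n) hn2 hnA le_rfl (by omega)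
  · exact h.isCompleteFactorization_twistedFactor hA le_rfl hn.le (by rw [hodd hdo])
  · obtain ⟨a, ha, -⟩ := h.exists_isCoeffs_init hu hw
    exact ⟨a, ha⟩
  -- Solvability for an arbitrary `a` at level `n - 1`: its polynomial is the minimal polynomial of
  -- any of its roots `y^2`, so the minimal polynomial of `y` supplies the next vector.
  · obtain ⟨z, hz⟩ := h.exists_aeval_coeffPoly ha.zero_eq_one
    obtain ⟨y, rfl⟩ := IsAlgClosed.exists_pow_nat_eq z two_pos
    obtain ⟨b, hb, -⟩ := h.exists_recurrenceStep hde (by omega) (by omega) ha.zero_eq_one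
      (h.isPrimitiveRoot_of_isCoeffs hde hu hw ha hz)
      (h.coeffPoly_eq_minpoly hde (by omega) hu hw ha hz)
    exact ⟨b, hb⟩
  · simpa using h.isCompleteFactorization_coeffPoly (n := n) hde hAn.le hnK le_rfl (by omega)
  · exact h.isCompleteFactorization_coeffPoly hde hAK le_rfl hKn.le rfl
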